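/- Let $\mu$ be a non-degenerate probability distribution on $\mathbb{R}$ (not a point mass) that is symmetric about zero, has zero mean, and is sub-exponential with parameters $(\nu,b)$, $\nu,b>0$, i.e. $\int e^{\lambda x}\,d\mu(x)\le e^{\lambda^2\nu^2/2}$ for all $|\lambda|\le 1/b$. For $\gamma>0$ and $v\in\mathbb{R}^n$ let $$\mathrm{LCD}_\gamma(v)=\inf\Big\{\theta>0:\ \mathrm{dist}(\theta v,\mathbb{Z}^n)\le \min\big\{\gamma,\tfrac1{10}\|\theta v\|\big\}\Big\},$$ where $\|\cdot\|$ is the Euclidean norm and $\mathrm{dist}$ the Euclidean distance. Then there are constants $C',c'>0$ depending only on $\mu$ such that for every $n\ge 1$, all i.i.d. random variables $X_1,\dots,X_n$ with distribution $\mu$, all $\alpha,\beta\in\mathbb{R}^n$ with $\alpha\ne 0$, and all $\gamma>0$, $$\mathbf{P}\Big\{\Big|\sum_{i=1}^n\alpha_iX_i\Big|\le\Big|\sum_{i=1}^n\beta_iX_i\Big|\Big\}\le C'\left(\frac{\|\beta\|}{\|\alpha\|}+\frac{1}{\mathrm{LCD}_\gamma(\alpha/\|\alpha\|)}+e^{-c'\gamma^2}\right).$$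 -/

import Mathlib

open MeasureTheory ProbabilityTheory

/-- A probability measure `μ` on the line is the law of a zero mean sub-exponential random
variable with parameters `(ν, b)`: `E[e^{λX}]` is finite and at most `e^{λ²ν²/2}` for
`|λ| ≤ 1/b`. -/
structure IsSubExponentialLaw (μ : Measure ℝ) (ν b : ℝ) : Prop where
  integrable_id : Integrable (fun x : ℝ => x) μ
  mean_zero : ∫ x, x ∂μ = 0
  integrable_exp : ∀ t : ℝ, |t| ≤ 1 / b → Integrable (fun x : ℝ => Real.exp (t * x)) μ
  mgf_le : ∀ t : ℝ, |t| ≤ 1 / b →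
    ∫ x, Real.exp (t * x) ∂μ ≤ Real.exp (t ^ 2 * ν ^ 2 / 2)

/-- The lattice `ℤⁿ` inside Euclidean space. -/
def integerLattice (n : ℕ) : Set (EuclideanSpace ℝ (Fin n)) :=
  {z | ∀ i, ∃ m : ℤ, z i = (m : ℝ)}

/-- The essential least common denominator of `α` at level `γ`, with the Euclidean norm and
distance. For `α ≠ 0` and `γ > 0` the set is nonempty by simultaneous Diophantine approximation
and bounded away from `0`, so the real infimum is genuine and positive. -/
noncomputable def essLCD {n : ℕ} (γ : ℝ) (α : EuclideanSpace ℝ (Fin n)) : ℝ :=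
  sInf {θ : ℝ | 0 < θ ∧
    Metric.infDist (θ • α) (integerLattice n) ≤ min γ ((1 / 10) * ‖θ • α‖)}

/-! Esseen's Fourier argument is run under an exponential tilt. Normalise `‖α‖ = 1` and put S = l ∑
αᵢXᵢ, T = l ∑ βᵢXᵢ for a scale l > 0. With K the Fejér kernel, 4 (e^T + e^{-T}) (K(S) + K(S - π)) ≥
1 on the event |S| ≤ |T| (`one_le_exp_mul_fejerKernel`). So T enters only through e^{±T}, and S only
through frequencies at most 1, leaving the integral of |E e^{±T} e^{iuS}| over 0 < u ≤ 1
(`integral_mul_fejerKernel_le`).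

By independence this expectation is a product over coordinates. Symmetrization bounds each factor by
a sub-Gaussian cost of the tilt times a cosine loss. The total cost is bounded if l‖β‖ ≤ 1/b. Below
the LCD the vector stays away from the lattice, so the total loss is at least a multiple of min(γ²,
(ul)²) (`norm_integral_tilted_cexp_le`). Integrating in u gives e^{-cγ²} plus a multiple of 1/l, and
1/l can be taken as b‖β‖ + M/LCD. -/

/-! ### Fejér kernel and Fourier majorant of the event. -/

/-- The Fejér kernel `2 (1 - cos x) / x²`, written as the Fourier transform of a compactly
supported function. -/
noncomputable def fejerKernel (x : ℝ) : ℝ :=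
  ∫ u in Set.Ioc (0 : ℝ) 1, 2 * (1 - u) * Real.cos (u * x)

lemma fejerKernel_mul_sq (x : ℝ) : fejerKernel x * x ^ 2 = 2 * (1 - Real.cos x) := by
  have hderiv : ∀ u ∈ Set.uIcc (0 : ℝ) 1, HasDerivAt
      (fun u => 2 * ((1 - u) * (Real.sin (u * x) * x) - Real.cos (u * x)))
      (2 * (1 - u) * Real.cos (u * x) * x ^ 2) u := by
    intro u _
    have h1 : HasDerivAt (fun u : ℝ => u * x) x u := by simpa using (hasDerivAt_id u).mul_const x
    have h2 : HasDerivAt (fun u : ℝ => 1 - u) (-1) u := by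
      simpa using (hasDerivAt_id u).const_sub 1
    have h := ((h2.mul (h1.sin.mul_const x)).sub h1.cos).const_mul 2
    refine h.congr_deriv ?_
    ring
  have hint : IntervalIntegrable (fun u : ℝ => 2 * (1 - u) * Real.cos (u * x) * x ^ 2)
      volume 0 1 := by
    apply Continuous.intervalIntegrable
    fun_prop
  have h := intervalIntegral.integral_eq_sub_of_hasDerivAt hderiv hint
  rw [intervalIntegral.integral_mul_const, intervalIntegral.integral_of_le zero_le_one] at h
  rw [fejerKernel, h]
  simp
  ring

lemma fejerKernel_nonneg (x : ℝ) : 0 ≤ fejerKernel x := by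
  rcases eq_or_ne x 0 with rfl | hx
  · refine setIntegral_nonneg measurableSet_Ioc fun u hu => ?_
    simp only [mul_zero, Real.cos_zero, mul_one]
    linarith [hu.2]
  · refine nonneg_of_mul_nonneg_left (b := x ^ 2) ?_ (by positivity)
    rw [fejerKernel_mul_sq]
    linarith [Real.cos_le_one x]

/-- The kernel vanishes at nonzero multiples of 2π. The shift by π removes these zeros, as the
numerators 2(1 - cos x) and 2(1 + cos x) add up to 4. -/
lemma four_le_fejerKernel_add (x : ℝ) :
    4 ≤ (|x| + 4) ^ 2 * (fejerKernel x + fejerKernel (x - Real.pi)) := by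
  have h1 := fejerKernel_mul_sq x
  have h2 := fejerKernel_mul_sq (x - Real.pi)
  rw [Real.cos_sub_pi] at h2
  have h3 : x ^ 2 ≤ (|x| + 4) ^ 2 := by
    rw [← sq_abs x]
    gcongr
    linarith
  have h4 : (x - Real.pi) ^ 2 ≤ (|x| + 4) ^ 2 := by
    rw [← sq_abs (x - Real.pi)]
    gcongr
    calc |x - Real.pi| ≤ |x| + |Real.pi| := abs_sub _ _
      _ ≤ |x| + 4 := by
        rw [abs_of_pos Real.pi_pos]
        linarith [Real.pi_le_four]
  have h5 := mul_le_mul_of_nonneg_left h3 (fejerKernel_nonneg x)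
  have h6 := mul_le_mul_of_nonneg_left h4 (fejerKernel_nonneg (x - Real.pi))
  linarith

/-- Replaces the indicator of `|x| ≤ |y|` by a product of an exponential in `y` and a function of
`x` whose Fourier transform has compact support. -/
lemma one_le_exp_mul_fejerKernel {x y : ℝ} (h : |x| ≤ |y|) :
    1 ≤ 4 * (Real.exp y + Real.exp (-y)) * (fejerKernel x + fejerKernel (x - Real.pi)) := by
  have hK : 0 ≤ fejerKernel x + fejerKernel (x - Real.pi) :=
    add_nonneg (fejerKernel_nonneg _) (fejerKernel_nonneg _)
  -- (|y| + 4)² ≤ 16 (1 + |y| + y²/2) ≤ 16 e^{|y|}.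
  have h1 : (|x| + 4) ^ 2 ≤ 16 * (Real.exp y + Real.exp (-y)) := by
    have h2 : (|x| + 4) ^ 2 ≤ (|y| + 4) ^ 2 := by gcongr
    have h3 := Real.quadratic_le_exp_of_nonneg (abs_nonneg y)
    have h4 := Real.exp_abs_le y
    nlinarith [abs_nonneg y, sq_nonneg |y|]
  have h5 := four_le_fejerKernel_add x
  have h6 := mul_le_mul_of_nonneg_right h1 hK
  linarith

lemma measurable_fejerKernel : Measurable fejerKernel := by
  have h : StronglyMeasurable fun p : ℝ × ℝ => 2 * (1 - p.2) * Real.cos (p.2 * p.1) :=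
    Continuous.stronglyMeasurable (by fun_prop)
  exact (h.integral_prod_right (ν := volume.restrict (Set.Ioc (0 : ℝ) 1))).measurable

lemma fejerKernel_le_two (x : ℝ) : fejerKernel x ≤ 2 := by
  have h := norm_setIntegral_le_of_norm_le_const (μ := volume) (s := Set.Ioc (0 : ℝ) 1) (C := 2)
    (f := fun u => 2 * (1 - u) * Real.cos (u * x)) (by simp) fun u hu => by
      rw [norm_mul, Real.norm_eq_abs, Real.norm_eq_abs, abs_of_nonneg (by linarith [hu.2])]
      nlinarith [Real.abs_cos_le_one (u * x), hu.1, hu.2, abs_nonneg (Real.cos (u * x))]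
  refine (le_abs_self _).trans ?_
  simpa [fejerKernel] using h

/-- Fubini moves the kernel's integral over u outside. The shift `θ` only contributes a unimodular
phase, and the 2 bounds the weight 2(1 - u). -/
lemma integral_mul_fejerKernel_le {E : Type*} [MeasurableSpace E] {ρ : Measure E} [SFinite ρ]
    {g S : E → ℝ} (hg : Integrable g ρ) (hS : Measurable S) (θ : ℝ)
    {H : ℝ → ℝ} (hH : IntegrableOn H (Set.Ioc 0 1))
    (hbound : ∀ u ∈ Set.Ioc (0 : ℝ) 1,
      ‖∫ x, (g x : ℂ) * Complex.exp ((u * S x : ℝ) * Complex.I) ∂ρ‖ ≤ H u) :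
    ∫ x, g x * fejerKernel (S x - θ) ∂ρ ≤ 2 * ∫ u in Set.Ioc (0 : ℝ) 1, H u := by
  have hprod : Integrable (Function.uncurry fun (x : E) (u : ℝ) =>
      g x * (2 * (1 - u) * Real.cos (u * (S x - θ))))
      (ρ.prod (volume.restrict (Set.Ioc (0 : ℝ) 1))) := by
    have h1 : Integrable (fun p : E × ℝ => g p.1 * (2 * (1 - p.2)))
        (ρ.prod (volume.restrict (Set.Ioc (0 : ℝ) 1))) := by
      refine hg.mul_prod (g := fun u : ℝ => 2 * (1 - u)) ?_
      exact (Continuous.integrableOn_Icc (by fun_prop)).mono_set Set.Ioc_subset_Icc_self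
    have h2 := h1.mul_bdd (c := 1) (g := fun p : E × ℝ => Real.cos (p.2 * (S p.1 - θ)))
      (Measurable.aestronglyMeasurable (by fun_prop))
      (Filter.Eventually.of_forall fun p => Real.abs_cos_le_one _)
    refine h2.congr (Filter.Eventually.of_forall fun p => ?_)
    simp only [Function.uncurry]
    ring
  have hswap := integral_integral_swap hprod
  have hL : ∫ x, g x * fejerKernel (S x - θ) ∂ρ =
      ∫ x, (∫ u in Set.Ioc (0 : ℝ) 1, g x * (2 * (1 - u) * Real.cos (u * (S x - θ)))) ∂ρ := by
    refine integral_congr_ae (Filter.Eventually.of_forall fun x => ?_)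
    simp only [fejerKernel]
    rw [integral_const_mul]
  rw [hL, hswap, ← integral_const_mul]
  refine setIntegral_mono_on hprod.integral_prod_right (hH.const_mul 2) measurableSet_Ioc
    fun u hu => ?_
  have hcos : ∫ x, g x * Real.cos (u * (S x - θ)) ∂ρ ≤ H u := by
    refine le_trans ?_ (hbound u hu)
    have hI : Integrable (fun x => (g x : ℂ) * Complex.exp ((u * S x : ℝ) * Complex.I)) ρ := by
      refine hg.ofReal.mul_bdd (c := 1)
        (Measurable.aestronglyMeasurable (by fun_prop)) (Filter.Eventually.of_forall fun x => ?_)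
      rw [Complex.norm_exp_ofReal_mul_I]
    have hre : ∫ x, g x * Real.cos (u * (S x - θ)) ∂ρ =
        (Complex.exp ((-(u * θ) : ℝ) * Complex.I) *
          ∫ x, (g x : ℂ) * Complex.exp ((u * S x : ℝ) * Complex.I) ∂ρ).re := by
      rw [← integral_const_mul]
      refine Eq.trans ?_ (integral_re (hI.const_mul _))
      refine integral_congr_ae (Filter.Eventually.of_forall fun x => ?_)
      have : Complex.exp ((-(u * θ) : ℝ) * Complex.I) *
          ((g x : ℂ) * Complex.exp ((u * S x : ℝ) * Complex.I)) =
          (g x : ℂ) * Complex.exp ((u * (S x - θ) : ℝ) * Complex.I) := by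
        rw [mul_left_comm, ← Complex.exp_add]
        congr 2
        push_cast
        ring
      simp only [this]
      rw [← Complex.exp_ofReal_mul_I_re]
      exact (Complex.re_ofReal_mul _ _).symm
    rw [hre]
    refine (Complex.re_le_norm _).trans ?_
    rw [norm_mul, Complex.norm_exp_ofReal_mul_I, one_mul]
  have hH0 : 0 ≤ H u := (norm_nonneg _).trans (hbound u hu)
  have hfac : ∫ x, g x * (2 * (1 - u) * Real.cos (u * (S x - θ))) ∂ρ =
      2 * (1 - u) * ∫ x, g x * Real.cos (u * (S x - θ)) ∂ρ := by
    rw [← integral_const_mul]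
    congr 1 with x
    ring
  rw [hfac]
  calc 2 * (1 - u) * ∫ x, g x * Real.cos (u * (S x - θ)) ∂ρ ≤ 2 * (1 - u) * H u := by
        gcongr
        linarith [hu.2]
    _ ≤ 2 * H u := by nlinarith [hu.1]

/-! ### Distance to the lattice and the least common denominator. -/

/-- This is cos x ≤ 1 - (2/π²) x² on [-π, π], at x = 2π(y - round y). -/
lemma eight_mul_sq_sub_round_le (y : ℝ) :
    8 * (y - round y) ^ 2 ≤ 1 - Real.cos (2 * Real.pi * y) := by
  have h1 : |2 * Real.pi * (y - round y)| ≤ Real.pi := by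
    rw [abs_mul, abs_of_pos Real.two_pi_pos]
    nlinarith [abs_sub_round y, Real.pi_pos]
  have h3 := Real.cos_le_one_sub_mul_cos_sq h1
  have h4 : Real.cos (2 * Real.pi * (y - round y)) = Real.cos (2 * Real.pi * y) := by
    rw [mul_sub, mul_comm (2 * Real.pi) (round y : ℝ), Real.cos_sub_int_mul_two_pi]
  rw [h4] at h3
  have h5 : 2 / Real.pi ^ 2 * (2 * Real.pi * (y - round y)) ^ 2 = 8 * (y - round y) ^ 2 := by
    field_simp
    ring
  linarith

lemma eight_mul_infDist_sq_le {n : ℕ} (v : EuclideanSpace ℝ (Fin n)) :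
    8 * Metric.infDist v (integerLattice n) ^ 2 ≤ ∑ i, (1 - Real.cos (2 * Real.pi * v i)) := by
  set z : EuclideanSpace ℝ (Fin n) := WithLp.toLp 2 fun i => (round (v i) : ℝ) with hz
  have hzmem : z ∈ integerLattice n := fun i => ⟨round (v i), rfl⟩
  have h1 : Metric.infDist v (integerLattice n) ^ 2 ≤ ∑ i, (v i - round (v i)) ^ 2 := by
    calc Metric.infDist v (integerLattice n) ^ 2 ≤ dist v z ^ 2 := by
          gcongr
          · exact Metric.infDist_nonneg
          · exact Metric.infDist_le_dist_of_mem hzmem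
      _ = ∑ i, (v i - round (v i)) ^ 2 := by
          rw [EuclideanSpace.dist_eq, Real.sq_sqrt (by positivity)]
          simp [Real.dist_eq, hz]
  calc 8 * Metric.infDist v (integerLattice n) ^ 2 ≤ ∑ i, 8 * (v i - round (v i)) ^ 2 := by
        rw [← Finset.mul_sum]
        linarith
    _ ≤ _ := Finset.sum_le_sum fun i _ => eight_mul_sq_sub_round_le (v i)

/-- The scales that the essential least common denominator minimizes over. -/
def lcdScales {n : ℕ} (γ : ℝ) (α : EuclideanSpace ℝ (Fin n)) : Set ℝ :=
  {θ : ℝ | 0 < θ ∧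
    Metric.infDist (θ • α) (integerLattice n) ≤ min γ ((1 / 10) * ‖θ • α‖)}

lemma bddBelow_lcdScales {n : ℕ} (γ : ℝ) (α : EuclideanSpace ℝ (Fin n)) :
    BddBelow (lcdScales γ α) := ⟨0, fun _ h => h.1.le⟩

lemma notMem_lcdScales_of_lt_essLCD {n : ℕ} {γ θ : ℝ} {α : EuclideanSpace ℝ (Fin n)}
    (h : θ < essLCD γ α) : θ ∉ lcdScales γ α :=
  notMem_of_lt_csInf h (bddBelow_lcdScales γ α)

lemma norm_le_infDist_integerLattice {n : ℕ} (v : EuclideanSpace ℝ (Fin n)) (hv : ‖v‖ ≤ 1 / 2) :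
    ‖v‖ ≤ Metric.infDist v (integerLattice n) := by
  have hne : (integerLattice n).Nonempty := ⟨0, fun i => ⟨0, by simp⟩⟩
  refine (Metric.le_infDist hne).2 fun z hz => ?_
  rw [EuclideanSpace.norm_eq, EuclideanSpace.dist_eq]
  gcongr with i
  obtain ⟨m, hm⟩ := hz i
  rw [hm, Real.dist_eq, Real.norm_eq_abs]
  have hvi : |v i| ≤ 1 / 2 := (PiLp.norm_apply_le v i).trans hv
  rcases eq_or_ne m 0 with rfl | hm0
  · simp
  · have h1 : (1 : ℝ) ≤ |(m : ℝ)| := by exact_mod_cast Int.one_le_abs hm0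
    have h2 := abs_sub_abs_le_abs_sub (m : ℝ) (v i)
    rw [abs_sub_comm] at h2
    linarith

/-- For θ < 1/2 the origin is a nearest lattice point to θα, so the distance is θ itself, more than
the allowed θ/10. Hence the LCD is positive when scales exist. -/
lemma half_le_of_mem_lcdScales {n : ℕ} {γ θ : ℝ} {α : EuclideanSpace ℝ (Fin n)} (hα : ‖α‖ = 1)
    (h : θ ∈ lcdScales γ α) : 1 / 2 ≤ θ := by
  by_contra! hlt
  obtain ⟨hθ, hd⟩ := h
  have hn : ‖θ • α‖ = θ := by rw [norm_smul, hα, mul_one, Real.norm_eq_abs, abs_of_pos hθ]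
  have h1 := norm_le_infDist_integerLattice (θ • α) (by rw [hn]; exact hlt.le)
  have h2 := h1.trans (hd.trans (min_le_right _ _))
  rw [hn] at h2
  linarith

/-- Below the least common denominator the vector `s α / (2π)` stays away from the lattice. -/
lemma min_sq_le_sum_one_sub_cos {n : ℕ} {γ R s : ℝ} {α : EuclideanSpace ℝ (Fin n)} (hγ : 0 < γ)
    (hα : ‖α‖ = 1) (hR : ∀ θ < R, θ ∉ lcdScales γ α) (hs0 : s ≠ 0)
    (hs : |s| < 2 * Real.pi * R) :
    8 * min (γ ^ 2) (s ^ 2 / (20 * Real.pi) ^ 2) ≤ ∑ i, (1 - Real.cos (s * α i)) := by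
  have hπ := Real.pi_pos
  set θ := |s| / (2 * Real.pi) with hθ
  have hθpos : 0 < θ := by positivity
  have hθR : θ < R := by
    rw [hθ, div_lt_iff₀ (by positivity)]
    linarith
  have hd : min γ ((1 / 10) * ‖θ • α‖) < Metric.infDist (θ • α) (integerLattice n) := by
    by_contra! h
    exact hR θ hθR ⟨hθpos, h⟩
  have hn : (1 / 10) * ‖θ • α‖ = |s| / (20 * Real.pi) := by
    rw [norm_smul, hα, mul_one, Real.norm_eq_abs, abs_of_pos hθpos, hθ]
    field_simp
    norm_num
  rw [hn] at hd
  have hsq : min (γ ^ 2) (s ^ 2 / (20 * Real.pi) ^ 2) = min γ (|s| / (20 * Real.pi)) ^ 2 := by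
    rw [← sq_abs s, ← div_pow]
    rcases le_total γ (|s| / (20 * Real.pi)) with h | h
    · rw [min_eq_left h, min_eq_left (by gcongr)]
    · rw [min_eq_right h, min_eq_right (by gcongr)]
  rw [hsq]
  calc 8 * min γ (|s| / (20 * Real.pi)) ^ 2
      ≤ 8 * Metric.infDist (θ • α) (integerLattice n) ^ 2 := by
        gcongr
    _ ≤ ∑ i, (1 - Real.cos (2 * Real.pi * (θ • α) i)) := eight_mul_infDist_sq_le _
    _ = ∑ i, (1 - Real.cos (s * α i)) := by
        refine Finset.sum_congr rfl fun i _ => ?_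
        have : 2 * Real.pi * (θ • α) i = |s| * α i := by
          rw [PiLp.smul_apply, smul_eq_mul, hθ]
          field_simp
        rw [this]
        rcases abs_choice s with h | h
        · rw [h]
        · rw [h, neg_mul, Real.cos_neg]

/-! ### Tilted characteristic function of one coordinate. -/

/-- Pairs of points of `[-M, M]` at distance at least `δ`. -/
def spreadPairs (M δ : ℝ) : Set (ℝ × ℝ) := {p | |p.1| ≤ M ∧ |p.2| ≤ M ∧ δ ≤ |p.1 - p.2|}

lemma measurableSet_spreadPairs (M δ : ℝ) : MeasurableSet (spreadPairs M δ) := by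
  refine (measurableSet_le (f := fun p : ℝ × ℝ => |p.1|) ?_ measurable_const).inter
    ((measurableSet_le (f := fun p : ℝ × ℝ => |p.2|) ?_ measurable_const).inter
      (measurableSet_le (g := fun p : ℝ × ℝ => |p.1 - p.2|) measurable_const ?_))
  all_goals exact Continuous.measurable (by fun_prop)

/-- Otherwise two independent copies agree almost surely, and by Fubini the law is a point mass. -/
lemma exists_measure_spreadPairs_pos (μ : Measure ℝ) [IsProbabilityMeasure μ]
    (hnondeg : ∀ a : ℝ, μ ≠ Measure.dirac a) :
    ∃ M δ : ℝ, 0 < M ∧ 0 < δ ∧ 0 < (μ.prod μ).real (spreadPairs M δ) := by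
  by_contra! hcon
  have hnull : ∀ k : ℕ, (μ.prod μ) (spreadPairs (k + 1) (1 / (k + 1))) = 0 := by
    intro k
    have h := hcon (k + 1) (1 / (k + 1)) (by positivity) (by positivity)
    exact (measureReal_eq_zero_iff).1 (le_antisymm h measureReal_nonneg)
  have hne : (μ.prod μ) {p : ℝ × ℝ | ¬ p.2 = p.1} = 0 := by
    refine measure_mono_null ?_ (measure_iUnion_null hnull)
    intro p hp
    have hpos : 0 < |p.1 - p.2| := abs_pos.2 (sub_ne_zero.2 fun h => hp h.symm)
    obtain ⟨k₁, hk₁⟩ := exists_nat_one_div_lt hpos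
    obtain ⟨k₂, hk₂⟩ := exists_nat_ge (max |p.1| |p.2|)
    rw [Set.mem_iUnion]
    refine ⟨max k₁ k₂, ?_, ?_, ?_⟩
    · have : (k₂ : ℝ) ≤ (max k₁ k₂ : ℕ) := by exact_mod_cast le_max_right _ _
      linarith [le_max_left |p.1| |p.2|]
    · have : (k₂ : ℝ) ≤ (max k₁ k₂ : ℕ) := by exact_mod_cast le_max_right _ _
      linarith [le_max_right |p.1| |p.2|]
    · refine le_trans ?_ hk₁.le
      have : (k₁ : ℝ) ≤ (max k₁ k₂ : ℕ) := by exact_mod_cast le_max_left _ _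
      gcongr
  have hae : ∀ᵐ x ∂μ, ∀ᵐ y ∂μ, y = x := Measure.ae_ae_of_ae_prod (ae_iff.2 hne)
  obtain ⟨a, ha⟩ := hae.exists
  refine hnondeg a ?_
  have h : μ.map id = μ.map fun _ => a := Measure.map_congr ha
  rw [Measure.map_id, Measure.map_const, measure_univ, one_smul] at h
  exact h

/-- The loss in the modulus of the characteristic function caused by pairs in `spreadPairs M δ`. -/
noncomputable def cosDefect (μ : Measure ℝ) (M δ τ : ℝ) : ℝ :=
  ∫ p in spreadPairs M δ, (1 - Real.cos (τ * (p.1 - p.2))) ∂(μ.prod μ)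

lemma cosDefect_nonneg (μ : Measure ℝ) (M δ τ : ℝ) : 0 ≤ cosDefect μ M δ τ :=
  integral_nonneg fun p => by simpa using Real.cos_le_one _

lemma integrable_one_sub_cos (μ : Measure ℝ) [IsProbabilityMeasure μ] (s : Set (ℝ × ℝ)) (τ : ℝ) :
    Integrable (fun p : ℝ × ℝ => 1 - Real.cos (τ * (p.1 - p.2))) ((μ.prod μ).restrict s) := by
  refine Integrable.of_bound (Measurable.aestronglyMeasurable (by fun_prop)) 2
    (Filter.Eventually.of_forall fun p => ?_)
  rw [Real.norm_eq_abs, abs_le]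
  constructor <;> linarith [Real.cos_le_one (τ * (p.1 - p.2)), Real.neg_one_le_cos (τ * (p.1 - p.2))]

lemma integrable_exp_mul_cexp {μ : Measure ℝ} {a : ℝ}
    (h : Integrable (fun x : ℝ => Real.exp (a * x)) μ) (τ : ℝ) :
    Integrable (fun x : ℝ => (Real.exp (a * x) : ℂ) * Complex.exp ((τ * x : ℝ) * Complex.I)) μ := by
  refine h.ofReal.mul_bdd (c := 1) (Measurable.aestronglyMeasurable (by fun_prop))
    (Filter.Eventually.of_forall fun x => ?_)
  rw [Complex.norm_exp_ofReal_mul_I]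

/-- Symmetrization of the exponentially tilted characteristic function. -/
lemma norm_integral_exp_mul_cexp_sq {μ : Measure ℝ} [IsProbabilityMeasure μ] {a : ℝ}
    (h : Integrable (fun x : ℝ => Real.exp (a * x)) μ) (τ : ℝ) :
    ‖∫ x, (Real.exp (a * x) : ℂ) * Complex.exp ((τ * x : ℝ) * Complex.I) ∂μ‖ ^ 2 =
      (∫ x, Real.exp (a * x) ∂μ) ^ 2 - ∫ p : ℝ × ℝ, Real.exp (a * p.1) * Real.exp (a * p.2) *
        (1 - Real.cos (τ * (p.1 - p.2))) ∂(μ.prod μ) := by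
  set f : ℝ → ℂ := fun x => (Real.exp (a * x) : ℂ) * Complex.exp ((τ * x : ℝ) * Complex.I) with hf
  have hfi : Integrable f μ := integrable_exp_mul_cexp h τ
  have hci : Integrable (fun x => (starRingEnd ℂ) (f x)) μ :=
    (Complex.conjCLE.toContinuousLinearMap.integrable_comp hfi)
  have h1 : ((‖∫ x, f x ∂μ‖ ^ 2 : ℝ) : ℂ) =
      ∫ p : ℝ × ℝ, f p.1 * (starRingEnd ℂ) (f p.2) ∂(μ.prod μ) := by
    rw [integral_prod_mul (f := f) (g := fun y => (starRingEnd ℂ) (f y)), integral_conj,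
      Complex.mul_conj, Complex.normSq_eq_norm_sq]
  have h2 : ‖∫ x, f x ∂μ‖ ^ 2 =
      ∫ p : ℝ × ℝ, Real.exp (a * p.1) * Real.exp (a * p.2) * Real.cos (τ * (p.1 - p.2))
        ∂(μ.prod μ) := by
    have h3 := congrArg Complex.re h1
    rw [Complex.ofReal_re] at h3
    rw [h3]
    refine (integral_re (hfi.mul_prod hci)).symm.trans
      (integral_congr_ae (Filter.Eventually.of_forall fun p => ?_))
    have : f p.1 * (starRingEnd ℂ) (f p.2) = ((Real.exp (a * p.1) * Real.exp (a * p.2) : ℝ) : ℂ) *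
        Complex.exp ((τ * (p.1 - p.2) : ℝ) * Complex.I) := by
      simp only [hf, map_mul, Complex.conj_ofReal, ← Complex.exp_conj, Complex.conj_I]
      rw [mul_mul_mul_comm, ← Complex.exp_add]
      push_cast
      congr 2
      ring
    simp only [this]
    rw [← Complex.exp_ofReal_mul_I_re]
    exact Complex.re_ofReal_mul _ _
  have h4 : (∫ x, Real.exp (a * x) ∂μ) ^ 2 =
      ∫ p : ℝ × ℝ, Real.exp (a * p.1) * Real.exp (a * p.2) ∂(μ.prod μ) := by
    rw [sq, integral_prod_mul (f := fun x => Real.exp (a * x)) (g := fun x => Real.exp (a * x))]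
  have hpi : Integrable (fun p : ℝ × ℝ => Real.exp (a * p.1) * Real.exp (a * p.2)) (μ.prod μ) :=
    h.mul_prod h
  have hpc : Integrable (fun p : ℝ × ℝ => Real.exp (a * p.1) * Real.exp (a * p.2) *
      (1 - Real.cos (τ * (p.1 - p.2)))) (μ.prod μ) := by
    refine hpi.mul_bdd (c := 2) (Measurable.aestronglyMeasurable (by fun_prop))
      (Filter.Eventually.of_forall fun p => ?_)
    rw [Real.norm_eq_abs, abs_le]
    constructor <;>
      linarith [Real.cos_le_one (τ * (p.1 - p.2)), Real.neg_one_le_cos (τ * (p.1 - p.2))]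
  rw [h2, h4, ← integral_sub hpi hpc]
  congr 1 with p
  ring

/-- The cost `a ^ 2 * ν ^ 2` is kept exact so that it sums over coordinates to ‖a‖²ν², with no
dependence on the dimension. -/
lemma norm_integral_exp_mul_cexp_sq_le {μ : Measure ℝ} [IsProbabilityMeasure μ] {ν b M δ a : ℝ}
    (hb : 0 < b) (hsub : IsSubExponentialLaw μ ν b) (ha : |a| ≤ 1 / b) (τ : ℝ) :
    ‖∫ x, (Real.exp (a * x) : ℂ) * Complex.exp ((τ * x : ℝ) * Complex.I) ∂μ‖ ^ 2 ≤
      Real.exp (a ^ 2 * ν ^ 2 - Real.exp (-(2 * M / b) - ν ^ 2 / b ^ 2) * cosDefect μ M δ τ) := by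
  have hint := hsub.integrable_exp a ha
  rw [norm_integral_exp_mul_cexp_sq hint τ]
  have h1 : (∫ x, Real.exp (a * x) ∂μ) ^ 2 ≤ Real.exp (a ^ 2 * ν ^ 2) := by
    calc (∫ x, Real.exp (a * x) ∂μ) ^ 2 ≤ Real.exp (a ^ 2 * ν ^ 2 / 2) ^ 2 := by
          gcongr
          exact hsub.mgf_le a ha
      _ = Real.exp (a ^ 2 * ν ^ 2) := by
          rw [← Real.exp_nat_mul]
          congr 1
          push_cast
          ring
  have hpc : Integrable (fun p : ℝ × ℝ => Real.exp (a * p.1) * Real.exp (a * p.2) *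
      (1 - Real.cos (τ * (p.1 - p.2)))) (μ.prod μ) := by
    refine (hint.mul_prod hint).mul_bdd (c := 2) (Measurable.aestronglyMeasurable (by fun_prop))
      (Filter.Eventually.of_forall fun p => ?_)
    rw [Real.norm_eq_abs, abs_le]
    constructor <;>
      linarith [Real.cos_le_one (τ * (p.1 - p.2)), Real.neg_one_le_cos (τ * (p.1 - p.2))]
  have h2 : Real.exp (-(2 * M / b)) * cosDefect μ M δ τ ≤
      ∫ p : ℝ × ℝ, Real.exp (a * p.1) * Real.exp (a * p.2) *
        (1 - Real.cos (τ * (p.1 - p.2))) ∂(μ.prod μ) := by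
    calc Real.exp (-(2 * M / b)) * cosDefect μ M δ τ
        = ∫ p in spreadPairs M δ, Real.exp (-(2 * M / b)) * (1 - Real.cos (τ * (p.1 - p.2)))
            ∂(μ.prod μ) := by rw [cosDefect, integral_const_mul]
      _ ≤ ∫ p in spreadPairs M δ, Real.exp (a * p.1) * Real.exp (a * p.2) *
            (1 - Real.cos (τ * (p.1 - p.2))) ∂(μ.prod μ) := by
          refine setIntegral_mono_on ((integrable_one_sub_cos μ _ τ).const_mul _)
            hpc.integrableOn (measurableSet_spreadPairs M δ) fun p hp => ?_
          have hbd : ∀ x : ℝ, |x| ≤ M → -(M / b) ≤ a * x := fun x hx => by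
            have : |a * x| ≤ 1 / b * M := by
              rw [abs_mul]
              gcongr
            have h' := neg_abs_le (a * x)
            rw [one_div_mul_eq_div] at this
            linarith
          rw [← Real.exp_add]
          have hc := Real.cos_le_one (τ * (p.1 - p.2))
          refine mul_le_mul_of_nonneg_right (Real.exp_le_exp.2 ?_) (by linarith)
          have e1 := hbd p.1 hp.1
          have e2 := hbd p.2 hp.2.1
          have e3 : 2 * M / b = M / b + M / b := by ring
          linarith
      _ ≤ _ := by
          refine setIntegral_le_integral hpc (Filter.Eventually.of_forall fun p => ?_)
          have hc := Real.cos_le_one (τ * (p.1 - p.2))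
          simp only [Pi.zero_apply]
          have : 0 ≤ 1 - Real.cos (τ * (p.1 - p.2)) := by linarith
          positivity
  have hG := cosDefect_nonneg μ M δ τ
  have h3 : a ^ 2 * ν ^ 2 ≤ ν ^ 2 / b ^ 2 := by
    have : a ^ 2 ≤ (1 / b) ^ 2 := by
      rw [← sq_abs a]
      gcongr
    calc a ^ 2 * ν ^ 2 ≤ (1 / b) ^ 2 * ν ^ 2 := by gcongr
      _ = ν ^ 2 / b ^ 2 := by ring
  set κ := Real.exp (-(2 * M / b) - ν ^ 2 / b ^ 2) with hκ
  set G := cosDefect μ M δ τ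
  -- The factor e^{-ν²/b²} in `κ` lets e^{a²ν²} be pulled out of the difference, after which 1 - x ≤
  -- e^{-x} applies.
  have h4 : Real.exp (a ^ 2 * ν ^ 2) * κ ≤ Real.exp (-(2 * M / b)) := by
    rw [hκ, ← Real.exp_add]
    exact Real.exp_le_exp.2 (by linarith)
  have h5 : 1 - κ * G ≤ Real.exp (-(κ * G)) := by
    linarith [Real.add_one_le_exp (-(κ * G))]
  calc _ ≤ Real.exp (a ^ 2 * ν ^ 2) - Real.exp (-(2 * M / b)) * G := by linarith
    _ ≤ Real.exp (a ^ 2 * ν ^ 2) - Real.exp (a ^ 2 * ν ^ 2) * κ * G := by gcongr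
    _ = Real.exp (a ^ 2 * ν ^ 2) * (1 - κ * G) := by ring
    _ ≤ Real.exp (a ^ 2 * ν ^ 2) * Real.exp (-(κ * G)) := by gcongr
    _ = _ := by rw [← Real.exp_add]; rfl

/-- `min_sq_le_sum_one_sub_cos` is integrated over pairs with s = t(x - y): the bound `M` gives |s|
≤ 2Mt < 2πR, and the separation `δ` gives |s| ≥ δt. -/
lemma le_sum_cosDefect {μ : Measure ℝ} [IsProbabilityMeasure μ] {M δ : ℝ} (hM : 0 < M)
    (hδ : 0 < δ) {n : ℕ} {γ R t : ℝ} {α : EuclideanSpace ℝ (Fin n)} (hγ : 0 < γ) (hα : ‖α‖ = 1)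
    (hR : ∀ θ < R, θ ∉ lcdScales γ α) (ht0 : 0 < t) (ht : t * M ≤ R) :
    8 * (μ.prod μ).real (spreadPairs M δ) * min (γ ^ 2) (δ ^ 2 / (20 * Real.pi) ^ 2 * t ^ 2) ≤
      ∑ i, cosDefect μ M δ (t * α i) := by
  simp only [cosDefect]
  rw [← integral_finsetSum _ fun i _ => integrable_one_sub_cos μ _ _]
  have hconst : 8 * (μ.prod μ).real (spreadPairs M δ) *
      min (γ ^ 2) (δ ^ 2 / (20 * Real.pi) ^ 2 * t ^ 2) =
      ∫ _ in spreadPairs M δ, 8 * min (γ ^ 2) (δ ^ 2 / (20 * Real.pi) ^ 2 * t ^ 2)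
        ∂(μ.prod μ) := by
    rw [setIntegral_const, smul_eq_mul]
    ring
  rw [hconst]
  refine setIntegral_mono_on (integrable_const _)
    (integrable_finsetSum _ fun i _ => integrable_one_sub_cos μ _ _)
    (measurableSet_spreadPairs M δ) fun p hp => ?_
  obtain ⟨hp1, hp2, hp3⟩ := hp
  have hz0 : t * (p.1 - p.2) ≠ 0 := by
    have : p.1 - p.2 ≠ 0 := abs_pos.1 (hδ.trans_le hp3)
    positivity
  have hz1 : |t * (p.1 - p.2)| < 2 * Real.pi * R := by
    rw [abs_mul, abs_of_pos ht0]
    have h1 : |p.1 - p.2| ≤ 2 * M := (abs_sub _ _).trans (by linarith)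
    have h2 : 0 < t * M := by positivity
    calc t * |p.1 - p.2| ≤ t * (2 * M) := by gcongr
      _ = 2 * 1 * (t * M) := by ring
      _ < 2 * Real.pi * (t * M) := by
        gcongr
        linarith [Real.pi_gt_three]
      _ ≤ 2 * Real.pi * R := by
        gcongr
  have hmain := min_sq_le_sum_one_sub_cos hγ hα hR hz0 hz1
  calc 8 * min (γ ^ 2) (δ ^ 2 / (20 * Real.pi) ^ 2 * t ^ 2)
      ≤ 8 * min (γ ^ 2) ((t * (p.1 - p.2)) ^ 2 / (20 * Real.pi) ^ 2) := by
        gcongr 8 * min _ ?_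
        have : δ ^ 2 ≤ (p.1 - p.2) ^ 2 := by
          rw [← sq_abs (p.1 - p.2)]
          gcongr
        rw [mul_pow t, div_mul_eq_mul_div, mul_comm (t ^ 2)]
        gcongr
    _ ≤ ∑ i, (1 - Real.cos (t * (p.1 - p.2) * α i)) := hmain
    _ = _ := by
        refine Finset.sum_congr rfl fun i _ => ?_
        rw [mul_right_comm]

/-! ### Product over coordinates and decay in the frequency. -/

lemma integrable_exp_sum_mul {μ : Measure ℝ} [IsProbabilityMeasure μ] {ν b : ℝ}
    (hsub : IsSubExponentialLaw μ ν b) {n : ℕ} {a : Fin n → ℝ} (ha : ∀ i, |a i| ≤ 1 / b) :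
    Integrable (fun x : Fin n → ℝ => Real.exp (∑ i, a i * x i)) (Measure.pi fun _ => μ) := by
  simp only [Real.exp_sum]
  exact Integrable.fintype_prod (f := fun i x => Real.exp (a i * x))
    fun i => hsub.integrable_exp (a i) (ha i)

lemma integral_exp_sum_mul_cexp_sum {μ : Measure ℝ} [IsProbabilityMeasure μ] {n : ℕ}
    (a τ : Fin n → ℝ) :
    ∫ x, (Real.exp (∑ i, a i * x i) : ℂ) * Complex.exp ((∑ i, τ i * x i : ℝ) * Complex.I)
        ∂(Measure.pi fun _ : Fin n => μ) =
      ∏ i, ∫ x, (Real.exp (a i * x) : ℂ) * Complex.exp ((τ i * x : ℝ) * Complex.I) ∂μ := by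
  rw [← integral_fintype_prod_eq_prod]
  congr 1 with x
  rw [Finset.prod_mul_distrib, Real.exp_sum, ← Complex.exp_sum]
  push_cast
  rw [Finset.sum_mul]

/-- Decay of the exponentially tilted characteristic function of `∑ i, α i * X i` below the
essential least common denominator. -/
lemma norm_integral_tilted_cexp_le {μ : Measure ℝ} [IsProbabilityMeasure μ] {ν b M δ : ℝ}
    (hb : 0 < b) (hsub : IsSubExponentialLaw μ ν b) (hM : 0 < M) (hδ : 0 < δ)
    {n : ℕ} {γ R t : ℝ} {α a : EuclideanSpace ℝ (Fin n)} (hγ : 0 < γ) (hα : ‖α‖ = 1)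
    (hR : ∀ θ < R, θ ∉ lcdScales γ α) (ht0 : 0 < t) (ht : t * M ≤ R) (ha : ‖a‖ ≤ 1 / b)
    {c : ℝ} (hc : c = 4 * Real.exp (-(2 * M / b) - ν ^ 2 / b ^ 2) *
      (μ.prod μ).real (spreadPairs M δ)) :
    ‖∫ x, (Real.exp (∑ i, a i * x i) : ℂ) * Complex.exp ((t * ∑ i, α i * x i : ℝ) * Complex.I)
        ∂(Measure.pi fun _ : Fin n => μ)‖ ≤
      Real.exp (ν ^ 2 / (2 * b ^ 2)) *
        (Real.exp (-c * γ ^ 2) + Real.exp (-(c * (δ ^ 2 / (20 * Real.pi) ^ 2)) * t ^ 2)) := by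
  set κ := Real.exp (-(2 * M / b) - ν ^ 2 / b ^ 2) with hκ
  set p := (μ.prod μ).real (spreadPairs M δ) with hp
  set d := δ ^ 2 / (20 * Real.pi) ^ 2 with hd
  set m := min (γ ^ 2) (d * t ^ 2) with hm
  have hai : ∀ i, |a i| ≤ 1 / b := fun i => (PiLp.norm_apply_le a i).trans ha
  have hfac := integral_exp_sum_mul_cexp_sum (μ := μ) a fun i => t * α i
  have hsum : ∀ x : Fin n → ℝ, ∑ i, t * α i * x i = t * ∑ i, α i * x i := fun x => by
    rw [Finset.mul_sum]
    simp only [mul_assoc]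
  simp only [hsum] at hfac
  rw [hfac]
  have hnorm : ∑ i, a i ^ 2 ≤ 1 / b ^ 2 := by
    have h1 : ∑ i, a i ^ 2 = ‖a‖ ^ 2 := by
      rw [EuclideanSpace.norm_sq_eq]
      simp
    rw [h1, ← one_div_pow]
    gcongr
  have hdef := le_sum_cosDefect (μ := μ) hM hδ hγ hα hR ht0 ht
  have hsq : ‖∏ i, ∫ x, (Real.exp (a i * x) : ℂ) *
      Complex.exp ((t * α i * x : ℝ) * Complex.I) ∂μ‖ ^ 2 ≤
      Real.exp (ν ^ 2 / (2 * b ^ 2) - c * m) ^ 2 := by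
    rw [norm_prod, ← Finset.prod_pow]
    calc _ ≤ ∏ i, Real.exp (a i ^ 2 * ν ^ 2 - κ * cosDefect μ M δ (t * α i)) :=
          Finset.prod_le_prod (fun i _ => by positivity) fun i _ =>
            norm_integral_exp_mul_cexp_sq_le hb hsub (hai i) _
      _ = Real.exp ((∑ i, a i ^ 2) * ν ^ 2 - κ * ∑ i, cosDefect μ M δ (t * α i)) := by
          rw [← Real.exp_sum, Finset.sum_sub_distrib, Finset.sum_mul, Finset.mul_sum]
      _ ≤ Real.exp (1 / b ^ 2 * ν ^ 2 - κ * (8 * p * m)) := by gcongr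
      -- Taking the square root halves the exponent, so the 8 becomes the 4 in `c`.
      _ = Real.exp (ν ^ 2 / (2 * b ^ 2) - c * m) ^ 2 := by
          rw [← Real.exp_nat_mul, hc]
          congr 1
          push_cast
          field_simp
          ring
  refine (le_of_sq_le_sq hsq (Real.exp_pos _).le).trans ?_
  rw [sub_eq_add_neg, Real.exp_add]
  gcongr
  rcases min_choice (γ ^ 2) (d * t ^ 2) with h | h <;> rw [hm, h]
  · have := Real.exp_pos (-(c * d) * t ^ 2)
    rw [neg_mul]
    linarith
  · have := Real.exp_pos (-c * γ ^ 2)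
    rw [neg_mul (c * d), mul_assoc]
    linarith

lemma setIntegral_exp_neg_mul_sq_le {q l : ℝ} (hq : 0 < q) (hl : 0 < l) :
    ∫ u in Set.Ioc (0 : ℝ) 1, Real.exp (-q * (u * l) ^ 2) ≤ √(Real.pi / q) * l⁻¹ := by
  have hfun : (fun u : ℝ => Real.exp (-q * (u * l) ^ 2)) =
      fun u => Real.exp (-(q * l ^ 2) * u ^ 2) := by
    ext u
    congr 1
    ring
  rw [hfun]
  calc _ ≤ ∫ u : ℝ, Real.exp (-(q * l ^ 2) * u ^ 2) :=
        setIntegral_le_integral (integrable_exp_neg_mul_sq (by positivity))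
          (Filter.Eventually.of_forall fun u => (Real.exp_pos _).le)
    _ = √(Real.pi / q) * l⁻¹ := by
        rw [integral_gaussian, ← div_div, Real.sqrt_div (by positivity), Real.sqrt_sq hl.le,
          div_eq_mul_inv]

/-! ### Comparison estimate and conclusion. -/

/-- The comparison estimate for a unit vector `α`, with any `R` below which there are no
admissible scales in place of the essential least common denominator. -/
lemma pi_measureReal_abs_le_abs_le {μ : Measure ℝ} [IsProbabilityMeasure μ] {ν b M δ : ℝ}
    (hb : 0 < b) (hsub : IsSubExponentialLaw μ ν b) (hM : 0 < M) (hδ : 0 < δ)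
    {n : ℕ} {γ R : ℝ} {α β : EuclideanSpace ℝ (Fin n)} (hγ : 0 < γ) (hα : ‖α‖ = 1)
    (hR0 : 0 < R) (hR : ∀ θ < R, θ ∉ lcdScales γ α)
    {c q : ℝ} (hc : c = 4 * Real.exp (-(2 * M / b) - ν ^ 2 / b ^ 2) *
      (μ.prod μ).real (spreadPairs M δ)) (hq : q = c * (δ ^ 2 / (20 * Real.pi) ^ 2))
    (hq0 : 0 < q) :
    (Measure.pi fun _ : Fin n => μ).real {x | |∑ i, α i * x i| ≤ |∑ i, β i * x i|} ≤
      32 * Real.exp (ν ^ 2 / (2 * b ^ 2)) *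
        (Real.exp (-c * γ ^ 2) + √(Real.pi / q) * (b * ‖β‖ + M / R)) := by
  set ρ := Measure.pi fun _ : Fin n => μ with hρ
  set A := Real.exp (ν ^ 2 / (2 * b ^ 2)) with hA
  -- Up to a factor 2, the largest scale with both `l * M ≤ R` (frequencies below the LCD) and `l *
  -- ‖β‖ ≤ 1 / b` (admissible tilt).
  set l := (b * ‖β‖ + M / R)⁻¹ with hl
  have hMR : 0 < M / R := by positivity
  have hbβ : 0 ≤ b * ‖β‖ := by positivity
  have hl0 : 0 < l := by positivity
  have hlM : l * M ≤ R := by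
    have : l ≤ (M / R)⁻¹ := inv_anti₀ hMR (by linarith)
    calc l * M ≤ (M / R)⁻¹ * M := by gcongr
      _ = R := by field_simp
  have hlβ : l * ‖β‖ ≤ 1 / b := by
    rw [hl, inv_mul_eq_div, div_le_div_iff₀ (by positivity) hb]
    linarith
  set S : (Fin n → ℝ) → ℝ := fun x => l * ∑ i, α i * x i with hS
  set T : (Fin n → ℝ) → ℝ := fun x => l * ∑ i, β i * x i with hT
  have hSm : Measurable S := by fun_prop
  set B := A * (Real.exp (-c * γ ^ 2) + √(Real.pi / q) * l⁻¹) with hB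
  have key : ∀ ε : ℝ, |ε| = 1 → Integrable (fun x => Real.exp (ε * T x)) ρ ∧
      ∀ θ, ∫ x, Real.exp (ε * T x) * fejerKernel (S x - θ) ∂ρ ≤ 2 * B := by
    intro ε hε
    have ha : ‖(ε * l) • β‖ ≤ 1 / b := by
      rw [norm_smul, norm_mul, Real.norm_eq_abs, hε, one_mul, Real.norm_eq_abs, abs_of_pos hl0]
      exact hlβ
    have hTa : ∀ x, ε * T x = ∑ i, ((ε * l) • β) i * x i := fun x => by
      simp only [hT, PiLp.smul_apply, smul_eq_mul, Finset.mul_sum]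
      refine Finset.sum_congr rfl fun i _ => ?_
      ring
    have hint : Integrable (fun x => Real.exp (ε * T x)) ρ := by
      simp only [hTa]
      exact integrable_exp_sum_mul hsub fun i => (PiLp.norm_apply_le _ i).trans ha
    refine ⟨hint, fun θ => ?_⟩
    have hgi : IntegrableOn (fun u : ℝ => Real.exp (-q * (u * l) ^ 2)) (Set.Ioc 0 1) :=
      (Continuous.integrableOn_Icc (by fun_prop)).mono_set Set.Ioc_subset_Icc_self
    have hci : IntegrableOn (fun _ : ℝ => Real.exp (-c * γ ^ 2)) (Set.Ioc 0 1) := by simp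
    refine (integral_mul_fejerKernel_le hint hSm θ
      (H := fun u => A * (Real.exp (-c * γ ^ 2) + Real.exp (-q * (u * l) ^ 2)))
      ((hci.add hgi).const_mul A) fun u hu => ?_).trans ?_
    · have hul : u * l * M ≤ R := by
        refine le_trans ?_ hlM
        rw [mul_assoc]
        exact mul_le_of_le_one_left (by positivity) hu.2
      have h := norm_integral_tilted_cexp_le hb hsub hM hδ hγ hα hR (mul_pos hu.1 hl0) hul ha hc
      rw [← hq] at h
      refine le_trans (le_of_eq ?_) h
      simp only [hTa, hS, hρ, mul_assoc]
    · rw [integral_const_mul, integral_add hci hgi, hB]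
      have := setIntegral_exp_neg_mul_sq_le hq0 hl0
      gcongr
      simp
  obtain ⟨hi1, hb1⟩ := key 1 (by simp)
  obtain ⟨hi2, hb2⟩ := key (-1) (by simp)
  have hKi : ∀ g : (Fin n → ℝ) → ℝ, Integrable g ρ → ∀ θ,
      Integrable (fun x => g x * fejerKernel (S x - θ)) ρ := fun g hg θ =>
    hg.mul_bdd (c := 2)
      (measurable_fejerKernel.comp (hSm.sub_const θ)).aestronglyMeasurable
      (Filter.Eventually.of_forall fun x => by
        rw [Real.norm_eq_abs, abs_of_nonneg (fejerKernel_nonneg _)]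
        exact fejerKernel_le_two _)
  have hEm : MeasurableSet {x : Fin n → ℝ | |∑ i, α i * x i| ≤ |∑ i, β i * x i|} :=
    measurableSet_le (by fun_prop) (by fun_prop)
  have hsum : ∀ g : (Fin n → ℝ) → ℝ, Integrable g ρ → Integrable
      (fun x => g x * fejerKernel (S x - 0) + g x * fejerKernel (S x - Real.pi)) ρ :=
    fun g hg => (hKi g hg 0).add (hKi g hg Real.pi)
  rw [← integral_indicator_one hEm]
  calc _ ≤ ∫ x, 4 * ((Real.exp (1 * T x) * fejerKernel (S x - 0) +
          Real.exp (1 * T x) * fejerKernel (S x - Real.pi)) +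
          (Real.exp (-1 * T x) * fejerKernel (S x - 0) +
          Real.exp (-1 * T x) * fejerKernel (S x - Real.pi))) ∂ρ := by
        refine integral_mono ((integrable_const 1).indicator hEm)
          (((hsum _ hi1).add (hsum _ hi2)).const_mul 4) fun x => ?_
        by_cases hx : x ∈ {x : Fin n → ℝ | |∑ i, α i * x i| ≤ |∑ i, β i * x i|}
        · rw [Set.indicator_of_mem hx]
          have hx' : |S x| ≤ |T x| := by
            simp only [hS, hT, abs_mul]
            exact mul_le_mul_of_nonneg_left hx (abs_nonneg l)
          refine (one_le_exp_mul_fejerKernel hx').trans (le_of_eq ?_)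
          rw [sub_zero, one_mul, neg_one_mul]
          ring
        · rw [Set.indicator_of_notMem hx]
          have h1 := fejerKernel_nonneg (S x - 0)
          have h2 := fejerKernel_nonneg (S x - Real.pi)
          positivity
    -- Two tilts ±1 and two shifts 0, π, each contributing at most `2 * B`; hence the constant 32.
    _ ≤ 4 * ((2 * B + 2 * B) + (2 * B + 2 * B)) := by
        rw [integral_const_mul, integral_add (hsum _ hi1) (hsum _ hi2),
          integral_add (hKi _ hi1 0) (hKi _ hi1 Real.pi),
          integral_add (hKi _ hi2 0) (hKi _ hi2 Real.pi)]
        have := hb1 0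
        have := hb1 Real.pi
        have := hb2 0
        have := hb2 Real.pi
        linarith
    _ = _ := by
        rw [hB, hl, inv_inv]
        ring

lemma measureReal_abs_le_abs_eq_pi {μ : Measure ℝ} {n : ℕ} {Ω : Type*} [MeasurableSpace Ω]
    {P : Measure Ω} {X : Fin n → Ω → ℝ} (hX : ∀ i, HasLaw (X i) μ P) (hindep : iIndepFun X P)
    (α β : Fin n → ℝ) :
    P.real {ω | |∑ i, α i * X i ω| ≤ |∑ i, β i * X i ω|} =
      (Measure.pi fun _ : Fin n => μ).real {x | |∑ i, α i * x i| ≤ |∑ i, β i * x i|} := by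
  have hm : ∀ i, AEMeasurable (X i) P := fun i => (hX i).aemeasurable
  have hmap := iIndepFun.map_fun_eq_pi_map hm hindep
  simp only [(hX _).map_eq] at hmap
  have hEm : MeasurableSet {x : Fin n → ℝ | |∑ i, α i * x i| ≤ |∑ i, β i * x i|} :=
    measurableSet_le (by fun_prop) (by fun_prop)
  rw [← hmap, map_measureReal_apply_of_aemeasurable (aemeasurable_pi_lambda _ hm) hEm]
  rfl

theorem mainTheorem1 (μ : Measure ℝ) [IsProbabilityMeasure μ] (ν b : ℝ) (hν : 0 < ν) (hb : 0 < b)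
    (hsub : IsSubExponentialLaw μ ν b)
    (hsymm : μ.map (fun x => -x) = μ)
    (hnondeg : ∀ a : ℝ, μ ≠ Measure.dirac a) :
    ∃ C c : ℝ, 0 < C ∧ 0 < c ∧
      ∀ (n : ℕ) (Ω : Type*) [MeasurableSpace Ω] (P : Measure Ω) [IsProbabilityMeasure P]
        (X : Fin n → Ω → ℝ), (∀ i, HasLaw (X i) μ P) → iIndepFun X P →
        ∀ (α β : EuclideanSpace ℝ (Fin n)), α ≠ 0 → ∀ γ : ℝ, 0 < γ →
          P.real {ω | |∑ i, α i * X i ω| ≤ |∑ i, β i * X i ω|} ≤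
            C * (‖β‖ / ‖α‖ + 1 / essLCD γ (‖α‖⁻¹ • α) + Real.exp (-c * γ ^ 2)) := by
  obtain ⟨M, δ, hM, hδ, hp⟩ := exists_measure_spreadPairs_pos μ hnondeg
  set c := 4 * Real.exp (-(2 * M / b) - ν ^ 2 / b ^ 2) * (μ.prod μ).real (spreadPairs M δ) with hc
  set q := c * (δ ^ 2 / (20 * Real.pi) ^ 2) with hq
  have hπ := Real.pi_pos
  have hc0 : 0 < c := by positivity
  have hq0 : 0 < q := by positivity
  set A := Real.exp (ν ^ 2 / (2 * b ^ 2))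
  have hA : 0 < A := Real.exp_pos _
  set r := √(Real.pi / q)
  have hr : 0 ≤ r := Real.sqrt_nonneg _
  refine ⟨32 * A * (1 + r * (b + M)), c, by positivity, hc0, ?_⟩
  intro n Ω _ P _ X hX hindep α β hα γ hγ
  have hα0 : 0 < ‖α‖ := norm_pos_iff.2 hα
  set α' := ‖α‖⁻¹ • α with hα'
  set β' := ‖α‖⁻¹ • β with hβ'
  have hα1 : ‖α'‖ = 1 := by
    rw [hα', norm_smul, norm_inv, norm_norm, inv_mul_cancel₀ hα0.ne']
  have hβ1 : ‖β‖ / ‖α‖ = ‖β'‖ := by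
    rw [hβ', norm_smul, norm_inv, norm_norm, inv_mul_eq_div]
  have hset : {x : Fin n → ℝ | |∑ i, α i * x i| ≤ |∑ i, β i * x i|} =
      {x | |∑ i, α' i * x i| ≤ |∑ i, β' i * x i|} := by
    ext x
    have hs : ∀ v : EuclideanSpace ℝ (Fin n),
        |∑ i, (‖α‖⁻¹ • v) i * x i| = ‖α‖⁻¹ * |∑ i, v i * x i| := fun v => by
      simp only [PiLp.smul_apply, smul_eq_mul, mul_assoc]
      rw [← Finset.mul_sum, abs_mul, abs_of_pos (inv_pos.2 hα0)]
    simp only [Set.mem_ofPred_eq, hα', hβ', hs]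
    exact (mul_le_mul_iff_right₀ (inv_pos.2 hα0)).symm
  rw [measureReal_abs_le_abs_eq_pi hX hindep, hset, hβ1]
  set e := Real.exp (-c * γ ^ 2) with he
  have he0 : 0 < e := Real.exp_pos _
  set L := essLCD γ α' with hL
  have hmain : ∀ R : ℝ, 0 < R → (∀ θ < R, θ ∉ lcdScales γ α') → 1 / R ≤ 1 / L + e →
      (Measure.pi fun _ : Fin n => μ).real {x | |∑ i, α' i * x i| ≤ |∑ i, β' i * x i|} ≤
        32 * A * (1 + r * (b + M)) * (‖β'‖ + 1 / L + e) := by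
    intro R hR0 hR hRL
    refine (pi_measureReal_abs_le_abs_le hb hsub hM hδ hγ hα1 hR0 hR hc hq hq0).trans ?_
    rw [mul_assoc (32 * A) (1 + r * (b + M))]
    refine mul_le_mul_of_nonneg_left ?_ (by positivity)
    set D := ‖β'‖ + 1 / L + e with hD
    have hLe : 0 ≤ 1 / L := by
      have : 0 ≤ L := Real.sInf_nonneg fun θ (h : θ ∈ lcdScales γ α') => h.1.le
      positivity
    have h1 : ‖β'‖ ≤ D := by linarith
    have h2 : M / R ≤ M * D := by
      rw [div_eq_mul_one_div]
      gcongr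
      linarith [norm_nonneg β']
    have h3 : e ≤ D := by linarith [norm_nonneg β']
    calc e + r * (b * ‖β'‖ + M / R) ≤ D + r * (b * D + M * D) := by gcongr
      _ = (1 + r * (b + M)) * D := by ring
  rcases (lcdScales γ α').eq_empty_or_nonempty with hempty | hne
  -- Without admissible scales the denominator is infinite, and every `R` may be used.
  · refine hmain (Real.exp (c * γ ^ 2)) (Real.exp_pos _) (by simp [hempty]) ?_
    -- Here `sInf ∅ = 0` and `1 / 0 = 0`, so the LCD term drops out; the chosen `R` makes `1 / R`
    -- equal to `e`.
    have hL0 : L = 0 := by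
      rw [hL, essLCD]
      exact (congrArg sInf hempty).trans Real.sInf_empty
    rw [hL0, div_zero, zero_add, one_div, ← Real.exp_neg, he, neg_mul]
  · have hLpos : 0 < L :=
      lt_of_lt_of_le one_half_pos (le_csInf hne fun θ h => half_le_of_mem_lcdScales hα1 h)
    exact hmain L hLpos (fun θ h => notMem_lcdScales_of_lt_essLCD h) (by linarith)
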